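/- Let $d,q\ge 0$ be integers, $Z$ a Banach space, $\sigma\ge 0$, $0<\beta\le 1$, and let $F:[0,\infty)\times Z\to Z$ be continuous and locally Lipschitz in the second variable: for all $R,T>0$ there is $L>0$ with $|F(t,z)-F(t,\tilde z)|_Z\le L|z-\tilde z|_Z$ whenever $t\in[0,T]$ and $|z|_Z,|\tilde z|_Z\le R$. Let $C_u(\mathbb{R}^d,Z)$ be the space of bounded uniformly continuous functions $\mathbb{R}^d\to Z$ with the supremum norm. Let $g_\beta$ be the function on $\mathbb{R}^d$ with Fourier transform $\int_{\mathbb{R}^d} g_\beta(x)e^{-ix\cdot\xi}\,dx=e^{-|\xi|^{2\beta}}$, and for $\sigma t>0$ put $G_{\sigma,\beta}(t,x)=(\sigma t)^{-d/(2\beta)}g_\beta\big((\sigma t)^{-1/(2\beta)}x\big)$ and $S(t)f=G_{\sigma,\beta}(t,\cdot)*f$; put $S(t)f=f$ if $\sigma t=0$. Given $u_0\in C_u(\mathbb{R}^d,Z)$ and an interval $I=[0,T]$ or $I=[0,T)$, a mild solution of $\partial_t u+\sigma(-\Delta)^\beta u=F(t,u)$, $u(0)=u_0$, on $I$ is a function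 $u\in C(I,C_u(\mathbb{R}^d,Z))$ such that for all $t\in I$ $$u(t)=S(t)u_0+\int_0^t S(t-s)F(s,u(s))\,ds,\qquad F(s,u(s))(x)=F(s,u(s)(x)),$$ the equation being understood at each point $x\in\mathbb{R}^d$, with an integrable integrand. Let $T^*(u_0)\in[0,\infty]$ be the supremum of all $T\ge 0$ such that a mild solution with initial datum $u_0$ exists on $[0,T]$. Let $\gamma_1,\dots,\gamma_q\in\mathbb{R}^d$ be linearly independent and $\Gamma=\{n_1\gamma_1+\dots+n_q\gamma_q:\ n_j\in\mathbb{Z}\}$; a function $v\in C_u(\mathbb{R}^d,Z)$ is called $\Gamma$-periodic if $v(x+\gamma)=v(x)$ for all $x\in\mathbb{R}^d$ and $\gamma\in\Gamma$. If $u_0\in C_u(\mathbb{R}^d,Z)$ is $\Gamma$-periodic and $u$ is the mild solution on $[0,T^*(u_0))$ with initial datum $u_0$, then $u(t)$ is $\Gamma$-periodic for every $0\le t<T^*(u_0)$. -/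

import Mathlib

open Set MeasureTheory
open scoped BoundedContinuousFunction FourierTransform

noncomputable section

/-- `C_u(ℝᵈ, Z)`: bounded uniformly continuous functions `ℝᵈ → Z`, with the supremum norm
(inherited from the bounded continuous functions). -/
def Cu (d : ℕ) (Z : Type*) [NormedAddCommGroup Z] [NormedSpace ℝ Z] :
    Submodule ℝ (EuclideanSpace ℝ (Fin d) →ᵇ Z) where
  carrier := {u | UniformContinuous u}
  zero_mem' := uniformContinuous_const
  add_mem' := fun hu hv => UniformContinuous.add hu hv
  smul_mem' := fun c _ hu => UniformContinuous.const_smul hu c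

/-- The function `g_β` on `ℝᵈ` whose Fourier transform `∫ g(x) e^{-i x·ξ} dx` is `e^{-|ξ|^{2β}}`.
Mathlib's Fourier transform is normalised with `e^{-2π i x·ξ}`, hence the factor `2π`. -/
def stableDensity (d : ℕ) (β : ℝ) (x : EuclideanSpace ℝ (Fin d)) : ℝ :=
  (𝓕⁻ (fun ξ : EuclideanSpace ℝ (Fin d) =>
    ((Real.exp (-((2 * Real.pi * ‖ξ‖) ^ (2 * β))) : ℝ) : ℂ)) x).re

/-- The Green function `G_{σ,β}(t, x) = (σt)^{-d/(2β)} g_β((σt)^{-1/(2β)} x)` of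
`∂ₜ + σ(-Δ)^β`, for `σ t > 0`. -/
def greenFunction (d : ℕ) (σ β t : ℝ) (x : EuclideanSpace ℝ (Fin d)) : ℝ :=
  (σ * t) ^ (-((d : ℝ) / (2 * β))) * stableDensity d β ((σ * t) ^ (-(1 / (2 * β))) • x)

/-- The semigroup generated by `-σ(-Δ)^β`: `S(t) f = G_{σ,β}(t, ·) * f` for `σ t > 0`, and the
identity for `t = 0` or `σ = 0`. -/
def fracSemigroup {d : ℕ} {Z : Type*} [NormedAddCommGroup Z] [NormedSpace ℝ Z]
    (σ β t : ℝ) (f : EuclideanSpace ℝ (Fin d) → Z) (x : EuclideanSpace ℝ (Fin d)) : Z :=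
  open Classical in
  if σ * t = 0 then f x else ∫ y, greenFunction d σ β t y • f (x - y)

/-- `F : ℝ₊ × Z → Z` is locally Lipschitz in the second variable. -/
def LocallyLipschitzInSnd {Z : Type*} [NormedAddCommGroup Z] (F : ℝ → Z → Z) : Prop :=
  ∀ R > 0, ∀ T > 0, ∃ L > 0, ∀ t ∈ Icc (0 : ℝ) T, ∀ z z' : Z, ‖z‖ ≤ R → ‖z'‖ ≤ R →
    ‖F t z - F t z'‖ ≤ L * ‖z - z'‖

/-- `u` is a mild solution of `∂ₜ u + σ(-Δ)^β u = F(t, u)` with initial datum `u₀` on the time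
interval `I` (of the form `[0, T]` or `[0, T)`): `u ∈ C(I, C_u(ℝᵈ, Z))` and
`u(t) = S(t) u₀ + ∫₀ᵗ S(t - s) F(s, u(s)) ds` for `t ∈ I`, where `F(s, u(s))(x) = F(s, u(s)(x))`.
The equation between functions on `ℝᵈ` is written out at each point `x`. -/
structure IsMildSolutionOn {d : ℕ} {Z : Type*} [NormedAddCommGroup Z] [NormedSpace ℝ Z]
    (σ β : ℝ) (F : ℝ → Z → Z) (u₀ : Cu d Z) (I : Set ℝ) (u : ℝ → Cu d Z) : Prop where
  continuousOn : ContinuousOn u I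
  integrable : ∀ t ∈ I, ∀ x : EuclideanSpace ℝ (Fin d),
    IntervalIntegrable
      (fun s => fracSemigroup σ β (t - s) (fun y => F s ((u s).1 y)) x) volume 0 t
  equation : ∀ t ∈ I, ∀ x : EuclideanSpace ℝ (Fin d),
    (u t).1 x = fracSemigroup σ β t (fun y => u₀.1 y) x
      + ∫ s in (0 : ℝ)..t, fracSemigroup σ β (t - s) (fun y => F s ((u s).1 y)) x

/-- The maximal time of existence `T*(u₀) ∈ [0, ∞]`: the supremum of the `T ≥ 0` for which there
is a mild solution on `[0, T]` with initial datum `u₀`. -/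
def maximalTime {d : ℕ} {Z : Type*} [NormedAddCommGroup Z] [NormedSpace ℝ Z]
    (σ β : ℝ) (F : ℝ → Z → Z) (u₀ : Cu d Z) : EReal :=
  sSup {τ : EReal | ∃ T : ℝ, 0 ≤ T ∧ τ = (T : EReal) ∧
    ∃ u : ℝ → Cu d Z, IsMildSolutionOn σ β F u₀ (Icc 0 T) u}

/-- The lattice `{n₁γ₁ + ⋯ + n_qγ_q : n_j ∈ ℤ}`. -/
def latticeOf {d q : ℕ} (γ : Fin q → EuclideanSpace ℝ (Fin d)) :
    Set (EuclideanSpace ℝ (Fin d)) :=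
  {v | ∃ n : Fin q → ℤ, v = ∑ j, n j • γ j}

/-- `C_u(ℝᵈ/Γ, Z)`: the `Γ`-periodic elements of `C_u(ℝᵈ, Z)`. -/
def CuPeriodic {d : ℕ} (Z : Type*) [NormedAddCommGroup Z] [NormedSpace ℝ Z]
    (Γ : Set (EuclideanSpace ℝ (Fin d))) : Set (Cu d Z) :=
  {u | ∀ v ∈ Γ, ∀ x, u.1 (x + v) = u.1 x}

end

open Filter Topology
open scoped RealInnerProductSpace

/-! The mild equation commutes with translations, so for a period `v` of the datum, `u(t)(· + v)`
solves the same equation as `u(t)`. The theorem is then the uniqueness argument: on a compact time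
interval `u` is bounded, `F` is Lipschitz on the relevant ball, and the sup norm `m(t)` of `u(t)(· +
v) - u(t)` satisfies `m(t) ≤ C L ∫₀ᵗ m`, so Grönwall gives `m = 0`.

This requires `S(t)` to be bounded on bounded functions uniformly in `t`. By scaling it is enough
that `g_β` is integrable, which is the analytic core (`integrable_stableDensity`). For `0 < β ≤ 1`,
`exp (-l ^ β)` is a limit of nonnegative combinations of exponentials `exp (-s l)`: the series `1 -
(1 - z) ^ β` has nonnegative coefficients, and its rescaled `n`-th powers at `z = e^{-y}` converge
to `exp (-l ^ β)`. With `l` a multiple of `|ξ|²` these are combinations of Gaussians, so `g_β ≥ 0`.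
A nonnegative Fourier transform of an integrable function bounded by 1 has integral at most 1, by
Gaussian regularisation and Fatou. -/

/-! ### Sibuya weights and the approximation of `exp (-x ^ β)` -/

theorem succ_mul_ringChoose_succ (a : ℝ) (k : ℕ) :
    ((k : ℝ) + 1) * Ring.choose a (k + 1) = (a - k) * Ring.choose a k := by
  have h1 := Ring.descPochhammer_eq_factorial_smul_choose a (k + 1)
  have h2 := Ring.descPochhammer_eq_factorial_smul_choose a k
  rw [descPochhammer_succ_right, Polynomial.smeval_mul, h2] at h1
  simp only [Polynomial.smeval_sub, Polynomial.smeval_X, Polynomial.smeval_natCast, nsmul_eq_mul,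
    pow_one, pow_zero, mul_one, Nat.factorial_succ, Nat.cast_mul, Nat.cast_succ] at h1
  have h3 : ((k.factorial : ℕ) : ℝ) ≠ 0 := by positivity
  apply mul_left_cancel₀ h3
  linear_combination -h1

/-- The weights of the Sibuya distribution, `1 - (1 - z) ^ β = ∑ a_k z ^ (k + 1)`. -/
noncomputable def sibuyaCoeff (β : ℝ) (k : ℕ) : ℝ := (-1) ^ k * Ring.choose β (k + 1)

/-- Consecutive weights have ratio `(k + 1 - β) / (k + 2)`, which is nonnegative because `β ≤ 1`. -/
theorem sibuyaCoeff_nonneg {β : ℝ} (h0 : 0 ≤ β) (h1 : β ≤ 1) (k : ℕ) : 0 ≤ sibuyaCoeff β k := by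
  induction k with
  | zero => simpa [sibuyaCoeff] using h0
  | succ k ih =>
    have h := succ_mul_ringChoose_succ β (k + 1)
    have : ((k : ℝ) + 2) * sibuyaCoeff β (k + 1) = (k + 1 - β) * sibuyaCoeff β k := by
      simp only [sibuyaCoeff]
      push_cast at h
      rw [pow_succ]
      linear_combination -(-1 : ℝ) ^ k * h
    have h2 : 0 ≤ ((k : ℝ) + 2) * sibuyaCoeff β (k + 1) := by
      rw [this]
      exact mul_nonneg (by have : (0 : ℝ) ≤ k := k.cast_nonneg
                           linarith) ih
    exact nonneg_of_mul_nonneg_right h2 (by positivity)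

theorem hasSum_sibuyaCoeff (β : ℝ) {z : ℝ} (hz0 : 0 ≤ z) (hz1 : z < 1) :
    HasSum (fun k => sibuyaCoeff β k * z ^ (k + 1)) (1 - (1 - z) ^ β) := by
  have h := (Real.one_add_rpow_hasFPowerSeriesOnBall_zero (a := β)).hasSum (y := -z) (by
    simp only [Metric.mem_eball, edist_zero_right]
    rw [← ofReal_norm, norm_neg, Real.norm_of_nonneg hz0]
    simpa using hz1)
  simp only [zero_add, binomialSeries_apply, List.ofFn_const, List.prod_replicate,
    smul_eq_mul] at h
  rw [← hasSum_nat_add_iff' 1] at h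
  simp only [Finset.range_one, Finset.sum_singleton, Ring.choose_zero_right, pow_zero,
    mul_one] at h
  have h' := h.neg
  rw [neg_sub, ← sub_eq_add_neg] at h'
  refine h'.congr_fun fun k => ?_
  simp only [sibuyaCoeff]
  rw [neg_pow z, pow_succ (-1 : ℝ)]
  ring

/-- Partial sums of the Laplace transform of the Sibuya distribution. -/
noncomputable def sibuyaLaplace (β : ℝ) (K : ℕ) (l : ℝ) : ℝ :=
  ∑ k ∈ Finset.range K, sibuyaCoeff β k * Real.exp (-((k + 1 : ℝ) * l))

theorem sibuyaLaplace_eq (β : ℝ) (K : ℕ) (l : ℝ) : sibuyaLaplace β K l =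
    ∑ k ∈ Finset.range K, sibuyaCoeff β k * Real.exp (-l) ^ (k + 1) := by
  refine Finset.sum_congr rfl fun k _ => ?_
  rw [← Real.exp_nat_mul]
  push_cast
  ring_nf

theorem tendsto_sibuyaLaplace (β : ℝ) {l : ℝ} (hl : 0 < l) :
    Tendsto (fun K => sibuyaLaplace β K l) atTop (𝓝 (1 - (1 - Real.exp (-l)) ^ β)) := by
  simp only [sibuyaLaplace_eq]
  exact (hasSum_sibuyaCoeff β (Real.exp_nonneg _)
    (Real.exp_lt_one_iff.2 (by linarith))).tendsto_sum_nat

theorem sibuyaLaplace_nonneg {β : ℝ} (h0 : 0 ≤ β) (h1 : β ≤ 1) (K : ℕ) (l : ℝ) :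
    0 ≤ sibuyaLaplace β K l :=
  Finset.sum_nonneg fun k _ => mul_nonneg (sibuyaCoeff_nonneg h0 h1 k) (Real.exp_nonneg _)

theorem sibuyaLaplace_le_one {β : ℝ} (h0 : 0 ≤ β) (h1 : β ≤ 1) (K : ℕ) {l : ℝ} (hl : 0 < l) :
    sibuyaLaplace β K l ≤ 1 := by
  have he : Real.exp (-l) < 1 := Real.exp_lt_one_iff.2 (by linarith)
  rw [sibuyaLaplace_eq]
  refine (sum_le_hasSum (Finset.range K) (fun k _ =>
    mul_nonneg (sibuyaCoeff_nonneg h0 h1 k) (by positivity))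
    (hasSum_sibuyaCoeff β (Real.exp_nonneg _) he)).trans ?_
  have : 0 ≤ (1 - Real.exp (-l)) ^ β := Real.rpow_nonneg (by linarith) _
  linarith

/-- With `y = x n ^ (-1/β)` one has `(1 - e^{-y}) ^ β ~ y ^ β = x ^ β / n`, so this is the limit of
`(1 - x ^ β / n) ^ n`. -/
theorem tendsto_sibuya_pow {β x : ℝ} (h0 : 0 < β) (hx : 0 < x) :
    Tendsto (fun n : ℕ => (1 - (1 - Real.exp (-(x * (n : ℝ) ^ (-(1 / β))))) ^ β) ^ n) atTop
      (𝓝 (Real.exp (-x ^ β))) := by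
  have hy : Tendsto (fun n : ℕ => x * (n : ℝ) ^ (-(1 / β))) atTop (𝓝[>] 0) := by
    refine tendsto_nhdsWithin_iff.2 ⟨?_, ?_⟩
    · have := ((tendsto_rpow_neg_atTop (show 0 < 1 / β by positivity)).comp
        tendsto_natCast_atTop_atTop).const_mul x
      simpa using this
    · filter_upwards [eventually_gt_atTop 0] with n hn
      have : (0 : ℝ) < n := by exact_mod_cast hn
      exact mul_pos hx (Real.rpow_pos_of_pos this _)
  have hd : Tendsto (fun y : ℝ => (1 - Real.exp (-y)) / y) (𝓝[>] 0) (𝓝 1) := by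
    have h := (((hasDerivAt_id (0 : ℝ)).neg.exp).const_sub 1).tendsto_slope.mono_left
      (nhdsGT_le_nhdsNE 0)
    simp only [slope_fun_def_field] at h
    simpa using h
  have h2 := ((hd.comp hy).rpow_const (p := β) (Or.inl one_ne_zero)).const_mul (x ^ β)
  simp only [Real.one_rpow, mul_one, Function.comp_def] at h2
  refine (Real.tendsto_one_add_pow_exp_of_tendsto
    (g := fun n : ℕ => -(1 - Real.exp (-(x * (n : ℝ) ^ (-(1 / β))))) ^ β) ?_).congr
    (fun n => by rw [← sub_eq_add_neg])
  refine h2.neg.congr' ?_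
  filter_upwards [eventually_gt_atTop 0] with n hn
  have hn' : (0 : ℝ) < n := by exact_mod_cast hn
  have hyp : 0 < x * (n : ℝ) ^ (-(1 / β)) := mul_pos hx (Real.rpow_pos_of_pos hn' _)
  have he : 0 ≤ 1 - Real.exp (-(x * (n : ℝ) ^ (-(1 / β)))) := by
    have := Real.exp_le_one_iff.2 (neg_nonpos.2 hyp.le)
    linarith
  rw [Real.div_rpow he hyp.le, Real.mul_rpow hx.le (Real.rpow_nonneg hn'.le _),
    ← Real.rpow_mul hn'.le, show -(1 / β) * β = -1 by field_simp, Real.rpow_neg_one]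
  have : x ^ β ≠ 0 := (Real.rpow_pos_of_pos hx _).ne'
  field_simp

/-! ### Positivity of Gaussian-regularised Fourier transforms -/

section GaussPos

variable {V : Type*} [NormedAddCommGroup V] [InnerProductSpace ℝ V] [FiniteDimensional ℝ V]
  [MeasurableSpace V] [BorelSpace V]

theorem integrable_exp_neg_mul_norm_sq {b : ℝ} (hb : 0 < b) :
    Integrable (fun v : V => Real.exp (-(b * ‖v‖ ^ 2))) := by
  have h := (GaussianFourier.integrable_cexp_neg_mul_sq_norm_add (V := V) (b := (b : ℂ))
    (by simpa using hb) 0 0).re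
  refine h.congr (ae_of_all _ fun v => ?_)
  simp only [zero_mul, add_zero]
  rw [show (-(b : ℂ) * (‖v‖ : ℂ) ^ 2) = ((-(b * ‖v‖ ^ 2) : ℝ) : ℂ) by push_cast; ring]
  exact Complex.exp_ofReal_re _

theorem integral_exp_neg_mul_norm_sq_mul_cos {b : ℝ} (hb : 0 < b) (w : V) :
    ∫ v : V, Real.exp (-(b * ‖v‖ ^ 2)) * Real.cos (2 * Real.pi * ⟪v, w⟫) =
      (Real.pi / b) ^ (Module.finrank ℝ V / 2 : ℝ) *
        Real.exp (-(Real.pi ^ 2 / b * ‖w‖ ^ 2)) := by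
  have hb' : 0 < (b : ℂ).re := by simpa using hb
  have h := GaussianFourier.integral_cexp_neg_mul_sq_norm_add (V := V) hb'
    (2 * Real.pi * Complex.I) w
  have hi := GaussianFourier.integrable_cexp_neg_mul_sq_norm_add (V := V) hb'
    (2 * Real.pi * Complex.I) w
  have h2 := congrArg Complex.re h
  rw [← RCLike.re_eq_complex_re, ← integral_re hi] at h2
  refine Eq.trans (integral_congr_ae (ae_of_all _ fun v => ?_)) (h2.trans ?_)
  · simp only [RCLike.re_eq_complex_re]
    rw [Complex.exp_re, real_inner_comm]
    congr 2 <;> simp [← Complex.ofReal_pow]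
  · rw [RCLike.re_eq_complex_re, ← Complex.ofReal_re ((Real.pi / b) ^ (_ : ℝ) * _)]
    congr 1
    rw [Complex.ofReal_mul, Complex.ofReal_cpow (by positivity)]
    push_cast
    congr 2
    have : (b : ℂ) ≠ 0 := by exact_mod_cast hb.ne'
    field_simp
    rw [Complex.I_sq]
    ring

variable (V) in
/-- `ψ` is bounded on `(0, ∞)`, and the regularised Fourier transform of `v ↦ ψ (‖v‖ ^ 2)` is
nonnegative for all Gaussian regularisations. -/
structure GaussPos (ψ : ℝ → ℝ) : Prop where
  measurable : Measurable ψ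
  bounded : ∃ C, ∀ l, 0 < l → |ψ l| ≤ C
  nonneg : ∀ b : ℝ, 0 < b → ∀ w : V,
    0 ≤ ∫ v : V, ψ (‖v‖ ^ 2) * Real.exp (-(b * ‖v‖ ^ 2)) * Real.cos (2 * Real.pi * ⟪v, w⟫)

/-- Bounds and limits of the profiles `ψ` are known only for `l > 0`, since the Sibuya series is
summed for `z < 1`; the origin is discarded as a null set. -/
theorem ae_norm_sq_pos [Nontrivial V] : ∀ᵐ v : V, 0 < ‖v‖ ^ 2 := by
  filter_upwards [compl_mem_ae_iff.2 (measure_singleton (0 : V))] with v hv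
  have : v ≠ 0 := by simpa using hv
  positivity

omit [FiniteDimensional ℝ V] in
theorem measurable_gaussPos_integrand {ψ : ℝ → ℝ} (hψ : Measurable ψ) (b : ℝ) (w : V) :
    Measurable fun v : V =>
      ψ (‖v‖ ^ 2) * Real.exp (-(b * ‖v‖ ^ 2)) * Real.cos (2 * Real.pi * ⟪v, w⟫) := by
  have h1 : Measurable fun v : V => ψ (‖v‖ ^ 2) := hψ.comp (by fun_prop)
  have h2 : Continuous fun v : V => Real.cos (2 * Real.pi * ⟪v, w⟫) := by fun_prop
  exact (h1.mul (by fun_prop)).mul h2.measurable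

omit [InnerProductSpace ℝ V] [FiniteDimensional ℝ V] [MeasurableSpace V] [BorelSpace V] in
theorem abs_gaussPos_integrand_le {C p b c : ℝ} {v : V} (hp : |p| ≤ C) :
    ‖p * Real.exp (-(b * ‖v‖ ^ 2)) * Real.cos c‖ ≤ C * Real.exp (-(b * ‖v‖ ^ 2)) := by
  rw [norm_mul, norm_mul, Real.norm_eq_abs, Real.norm_eq_abs, Real.norm_eq_abs, Real.abs_exp]
  have h1 := Real.abs_cos_le_one c
  have h2 : |p| * Real.exp (-(b * ‖v‖ ^ 2)) ≤ C * Real.exp (-(b * ‖v‖ ^ 2)) := by gcongr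
  refine (mul_le_of_le_one_right (by positivity) h1).trans h2

namespace GaussPos

variable [Nontrivial V] {ψ ψ' : ℝ → ℝ}

theorem integrable (h : GaussPos V ψ) {b : ℝ} (hb : 0 < b) (w : V) :
    Integrable fun v : V =>
      ψ (‖v‖ ^ 2) * Real.exp (-(b * ‖v‖ ^ 2)) * Real.cos (2 * Real.pi * ⟪v, w⟫) := by
  obtain ⟨C, hC⟩ := h.bounded
  refine Integrable.mono' ((integrable_exp_neg_mul_norm_sq hb).const_mul C)
    (measurable_gaussPos_integrand h.measurable b w).aestronglyMeasurable ?_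
  filter_upwards [ae_norm_sq_pos (V := V)] with v hv
  exact abs_gaussPos_integrand_le (hC _ hv)

omit [Nontrivial V] in
theorem one : GaussPos V fun _ => 1 where
  measurable := measurable_const
  bounded := ⟨1, fun _ _ => by simp⟩
  nonneg b hb w := by
    simp only [one_mul]
    rw [integral_exp_neg_mul_norm_sq_mul_cos hb]
    positivity

omit [Nontrivial V] in
theorem zero : GaussPos V fun _ => 0 where
  measurable := measurable_const
  bounded := ⟨0, fun _ _ => by simp⟩
  nonneg b hb w := by simp

theorem add (h : GaussPos V ψ) (h' : GaussPos V ψ') : GaussPos V fun l => ψ l + ψ' l where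
  measurable := h.measurable.add h'.measurable
  bounded := by
    obtain ⟨C, hC⟩ := h.bounded
    obtain ⟨C', hC'⟩ := h'.bounded
    exact ⟨C + C', fun l hl => (abs_add_le _ _).trans (add_le_add (hC l hl) (hC' l hl))⟩
  nonneg b hb w := by
    simp only [add_mul]
    rw [integral_add (h.integrable hb w) (h'.integrable hb w)]
    exact add_nonneg (h.nonneg b hb w) (h'.nonneg b hb w)

omit [Nontrivial V] in
-- The factor `e^{-s l}` is absorbed by the regularisation, turning `b` into `b + s`; this is why
-- positivity is required for every `b > 0`.
theorem mul_exp (h : GaussPos V ψ) {a s : ℝ} (ha : 0 ≤ a) (hs : 0 ≤ s) :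
    GaussPos V fun l => a * Real.exp (-(s * l)) * ψ l where
  measurable := by have := h.measurable; fun_prop
  bounded := by
    obtain ⟨C, hC⟩ := h.bounded
    refine ⟨a * C, fun l hl => ?_⟩
    rw [abs_mul, abs_mul, abs_of_nonneg ha, Real.abs_exp]
    have h1 : Real.exp (-(s * l)) ≤ 1 := Real.exp_le_one_iff.2 (neg_nonpos.2 (by positivity))
    have h2 : a * Real.exp (-(s * l)) ≤ a := mul_le_of_le_one_right ha h1
    exact mul_le_mul h2 (hC l hl) (abs_nonneg _) ha
  nonneg b hb w := by
    have := mul_nonneg ha (h.nonneg (b + s) (by positivity) w)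
    rw [← integral_const_mul] at this
    refine this.trans_eq (integral_congr_ae (ae_of_all _ fun v => ?_))
    simp only
    rw [show -((b + s) * ‖v‖ ^ 2) = -(s * ‖v‖ ^ 2) + -(b * ‖v‖ ^ 2) by ring, Real.exp_add]
    ring

theorem mul_sibuyaLaplace (h : GaussPos V ψ) {β c : ℝ} (h0 : 0 ≤ β) (h1 : β ≤ 1) (hc : 0 ≤ c)
    (K : ℕ) : GaussPos V fun l => sibuyaLaplace β K (c * l) * ψ l := by
  simp only [sibuyaLaplace]
  induction K with
  | zero => simpa using zero
  | succ K ih =>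
    simp only [Finset.sum_range_succ, add_mul _ _ (ψ _)]
    refine ih.add ?_
    simpa only [mul_assoc] using h.mul_exp (sibuyaCoeff_nonneg h0 h1 K)
      (show 0 ≤ (K + 1 : ℝ) * c by positivity)

theorem sibuyaLaplace_pow {β c : ℝ} (h0 : 0 ≤ β) (h1 : β ≤ 1) (hc : 0 ≤ c) (K n : ℕ) :
    GaussPos V fun l => sibuyaLaplace β K (c * l) ^ n := by
  induction n with
  | zero => simpa using one
  | succ n ih => simpa only [pow_succ'] using ih.mul_sibuyaLaplace h0 h1 hc K

theorem of_tendsto {φ : ℕ → ℝ → ℝ} (h : ∀ n, GaussPos V (φ n))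
    (hb : ∀ n l, 0 < l → |φ n l| ≤ 1) (hψ : Measurable ψ)
    (hl : ∀ l, 0 < l → Tendsto (fun n => φ n l) atTop (𝓝 (ψ l))) : GaussPos V ψ where
  measurable := hψ
  bounded := ⟨1, fun l hl' => le_of_tendsto (hl l hl').abs (Eventually.of_forall fun n =>
    hb n l hl')⟩
  nonneg b hb' w := by
    refine ge_of_tendsto' (tendsto_integral_of_dominated_convergence
      (fun v : V => 1 * Real.exp (-(b * ‖v‖ ^ 2)))
      (fun n => (measurable_gaussPos_integrand (h n).measurable b w).aestronglyMeasurable)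
      ((integrable_exp_neg_mul_norm_sq hb').const_mul 1) (fun n => ?_) ?_)
      fun n => (h n).nonneg b hb' w
    · filter_upwards [ae_norm_sq_pos (V := V)] with v hv
      exact abs_gaussPos_integrand_le (hb n _ hv)
    · filter_upwards [ae_norm_sq_pos (V := V)] with v hv
      exact ((hl _ hv).mul_const _).mul_const _

/-- Two successive limits: `K → ∞` sums the Sibuya series for fixed `n`, then `n → ∞` is
`tendsto_sibuya_pow`. All approximants lie in `[0, 1]`. -/
theorem exp_neg_rpow {β c : ℝ} (h0 : 0 < β) (h1 : β ≤ 1) (hc : 0 < c) :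
    GaussPos V fun l => Real.exp (-(c * l) ^ β) := by
  have hs : ∀ n : ℕ, 0 ≤ c * (n : ℝ) ^ (-(1 / β)) := fun n => by positivity
  refine of_tendsto (φ := fun n l =>
    (1 - (1 - Real.exp (-(c * l * (n : ℝ) ^ (-(1 / β))))) ^ β) ^ n) (fun n => ?_) (fun n l hl => ?_)
    (by fun_prop) fun l hl => tendsto_sibuya_pow h0 (mul_pos hc hl)
  -- For `n = 0` the scale `0 ^ (-(1 / β))` is `0`, where the series limit is not available, but the
  -- zeroth power is `1`.
  · rcases Nat.eq_zero_or_pos n with rfl | hn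
    · simpa using one
    have hn' : (0 : ℝ) < n := by exact_mod_cast hn
    have hsn : 0 < c * (n : ℝ) ^ (-(1 / β)) := by positivity
    refine of_tendsto (fun K => sibuyaLaplace_pow h0.le h1 (hs n) K n) (fun K l hl => ?_)
      (by fun_prop) fun l hl => ?_
    · rw [abs_of_nonneg (pow_nonneg (sibuyaLaplace_nonneg h0.le h1 _ _) _)]
      exact pow_le_one₀ (sibuyaLaplace_nonneg h0.le h1 _ _)
        (sibuyaLaplace_le_one h0.le h1 _ (by positivity))
    · rw [mul_right_comm]
      exact (tendsto_sibuyaLaplace β (by positivity)).pow n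
  · have he : Real.exp (-(c * l * (n : ℝ) ^ (-(1 / β)))) ≤ 1 :=
      Real.exp_le_one_iff.2 (neg_nonpos.2 (by positivity))
    have h2 : (1 - Real.exp (-(c * l * (n : ℝ) ^ (-(1 / β))))) ^ β ≤ 1 :=
      Real.rpow_le_one (by linarith) (by have := Real.exp_nonneg (-(c * l * (n : ℝ) ^ (-(1 / β))))
                                         linarith) h0.le
    have h3 : 0 ≤ (1 - Real.exp (-(c * l * (n : ℝ) ^ (-(1 / β))))) ^ β :=
      Real.rpow_nonneg (by linarith) _
    rw [abs_of_nonneg (pow_nonneg (by linarith) _)]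
    exact pow_le_one₀ (by linarith) (by linarith)

end GaussPos

end GaussPos

/-! ### Integrability of nonnegative radial Fourier transforms -/

section GaussPos

variable {V : Type*} [NormedAddCommGroup V] [InnerProductSpace ℝ V] [FiniteDimensional ℝ V]
  [MeasurableSpace V] [BorelSpace V]

/-- The Fourier transform of the radial function `v ↦ ψ (‖v‖ ^ 2)`. -/
noncomputable def radialFourier (ψ : ℝ → ℝ) (w : V) : ℝ :=
  ∫ v : V, ψ (‖v‖ ^ 2) * Real.cos (2 * Real.pi * ⟪v, w⟫)

theorem continuous_radialFourier {ψ : ℝ → ℝ} (hi : Integrable fun v : V => ψ (‖v‖ ^ 2)) :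
    Continuous (radialFourier ψ : V → ℝ) := by
  refine continuous_of_dominated (bound := fun v : V => ‖ψ (‖v‖ ^ 2)‖) (fun w => ?_) (fun w => ?_)
    hi.norm (ae_of_all _ fun v => by fun_prop)
  · exact hi.aestronglyMeasurable.mul (Continuous.aestronglyMeasurable (by fun_prop))
  · refine ae_of_all _ fun v => ?_
    rw [norm_mul]
    exact mul_le_of_le_one_right (norm_nonneg _) (Real.abs_cos_le_one _)

theorem GaussPos.radialFourier_nonneg {ψ : ℝ → ℝ} (h : GaussPos V ψ)
    (hi : Integrable fun v : V => ψ (‖v‖ ^ 2)) (w : V) : 0 ≤ radialFourier ψ w := by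
  have hn : Tendsto (fun n : ℕ => 1 / ((n : ℝ) + 1)) atTop (𝓝 0) :=
    tendsto_one_div_add_atTop_nhds_zero_nat
  refine ge_of_tendsto' (tendsto_integral_of_dominated_convergence
    (F := fun (n : ℕ) (v : V) => ψ (‖v‖ ^ 2) * Real.exp (-(1 / ((n : ℝ) + 1) * ‖v‖ ^ 2)) *
      Real.cos (2 * Real.pi * ⟪v, w⟫))
    (fun v : V => ‖ψ (‖v‖ ^ 2)‖)
    (fun n => (measurable_gaussPos_integrand h.measurable _ w).aestronglyMeasurable)
    hi.norm (fun n => ae_of_all _ fun v => ?_) (ae_of_all _ fun v => ?_))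
    fun n => h.nonneg (1 / ((n : ℝ) + 1)) (by positivity) w
  · refine (abs_gaussPos_integrand_le le_rfl).trans (mul_le_of_le_one_right (abs_nonneg _) ?_)
    exact Real.exp_le_one_iff.2 (neg_nonpos.2 (by positivity))
  · refine Tendsto.mul_const _ ?_
    have := ((hn.mul_const (‖v‖ ^ 2)).neg.rexp).const_mul (ψ (‖v‖ ^ 2))
    simpa using this

/-- Fubini moves the Gaussian onto `ψ`, where its Fourier transform is a probability density; the
integral is thus an average of values of `ψ`. -/
theorem integral_radialFourier_mul_gaussian_le {ψ : ℝ → ℝ} [Nontrivial V]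
    (hi : Integrable fun v : V => ψ (‖v‖ ^ 2)) (hψ : ∀ l, 0 < l → ψ l ≤ 1) {b : ℝ} (hb : 0 < b) :
    ∫ w : V, radialFourier ψ w * Real.exp (-(b * ‖w‖ ^ 2)) ≤ 1 := by
  have hprod : Integrable (Function.uncurry fun (w v : V) =>
      ψ (‖v‖ ^ 2) * Real.cos (2 * Real.pi * ⟪v, w⟫) * Real.exp (-(b * ‖w‖ ^ 2)))
      (volume.prod volume) := by
    have h1 := (integrable_exp_neg_mul_norm_sq (V := V) hb).mul_prod hi
    refine Integrable.mono (g := fun z : V × V => Real.exp (-(b * ‖z.1‖ ^ 2)) * ψ (‖z.2‖ ^ 2))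
      h1 ?_ (ae_of_all _ fun z => ?_)
    · have h2 := h1.aestronglyMeasurable.mul (Continuous.aestronglyMeasurable
        (f := fun z : V × V => Real.cos (2 * Real.pi * ⟪z.2, z.1⟫)) (by fun_prop))
      refine h2.congr (ae_of_all _ fun z => ?_)
      simp only [Function.uncurry, Pi.mul_apply]
      ring
    · simp only [Function.uncurry, norm_mul]
      rw [mul_comm (‖Real.exp _‖)]
      refine mul_le_mul_of_nonneg_right ?_ (norm_nonneg _)
      exact mul_le_of_le_one_right (norm_nonneg _) (Real.abs_cos_le_one _)
  simp only [radialFourier, ← integral_mul_const]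
  rw [integral_integral_swap hprod]
  have hinner : ∀ v : V, ∫ w : V, ψ (‖v‖ ^ 2) * Real.cos (2 * Real.pi * ⟪v, w⟫) *
      Real.exp (-(b * ‖w‖ ^ 2)) = ψ (‖v‖ ^ 2) * ((Real.pi / b) ^ (Module.finrank ℝ V / 2 : ℝ) *
        Real.exp (-(Real.pi ^ 2 / b * ‖v‖ ^ 2))) := fun v => by
    rw [← integral_exp_neg_mul_norm_sq_mul_cos hb, ← integral_const_mul]
    refine integral_congr_ae (ae_of_all _ fun w => ?_)
    simp only
    rw [real_inner_comm]
    ring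
  simp only [hinner]
  have hpb : 0 < Real.pi ^ 2 / b := by positivity
  have hone : ∫ v : V, (Real.pi / b) ^ (Module.finrank ℝ V / 2 : ℝ) *
        Real.exp (-(Real.pi ^ 2 / b * ‖v‖ ^ 2)) = 1 := by
    have h0 := integral_exp_neg_mul_norm_sq_mul_cos hpb (0 : V)
    simp only [inner_zero_right, mul_zero, Real.cos_zero, mul_one, norm_zero] at h0
    rw [integral_const_mul, h0]
    simp only [ne_eq, OfNat.ofNat_ne_zero, not_false_eq_true, zero_pow, mul_zero, neg_zero,
      Real.exp_zero, mul_one]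
    rw [← Real.mul_rpow (by positivity) (by positivity)]
    have : Real.pi / b * (Real.pi / (Real.pi ^ 2 / b)) = 1 := by
      have := Real.pi_ne_zero
      field_simp
    rw [this, Real.one_rpow]
  rw [← hone]
  refine integral_mono_ae ?_ ((integrable_exp_neg_mul_norm_sq hpb).const_mul _) ?_
  · refine (hprod.integral_prod_right).congr (ae_of_all _ fun v => hinner v)
  · filter_upwards [ae_norm_sq_pos (V := V)] with v hv
    exact mul_le_of_le_one_left (by positivity) (hψ _ hv)

/-- By nonnegativity, the bound on Gaussian-weighted integrals bounds `L¹` norms uniformly in `b`;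
Fatou applies as `b = 1 / (n + 1) → 0`. -/
theorem GaussPos.integrable_radialFourier {ψ : ℝ → ℝ} [Nontrivial V] (h : GaussPos V ψ)
    (hi : Integrable fun v : V => ψ (‖v‖ ^ 2)) (hψ : ∀ l, 0 < l → ψ l ≤ 1) :
    Integrable (radialFourier ψ : V → ℝ) := by
  have hc := continuous_radialFourier hi
  have hbd : ∀ w : V, ‖radialFourier ψ w‖ ≤ ∫ v : V, ‖ψ (‖v‖ ^ 2)‖ := fun w => by
    refine norm_integral_le_of_norm_le hi.norm (ae_of_all _ fun v => ?_)
    rw [norm_mul]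
    exact mul_le_of_le_one_right (norm_nonneg _) (Real.abs_cos_le_one _)
  have hG : ∀ b : ℝ, 0 < b →
      Integrable fun w : V => radialFourier ψ w * Real.exp (-(b * ‖w‖ ^ 2)) := fun b hb =>
    (integrable_exp_neg_mul_norm_sq hb).bdd_mul hc.aestronglyMeasurable (ae_of_all _ hbd)
  have hn : Tendsto (fun n : ℕ => 1 / ((n : ℝ) + 1)) atTop (𝓝 0) :=
    tendsto_one_div_add_atTop_nhds_zero_nat
  refine ⟨hc.aestronglyMeasurable, ?_⟩
  have hlim : ∀ w : V, Tendsto (fun n : ℕ =>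
      ‖radialFourier ψ w * Real.exp (-(1 / ((n : ℝ) + 1) * ‖w‖ ^ 2))‖ₑ) atTop
      (𝓝 ‖radialFourier ψ w‖ₑ) := fun w => by
    refine Tendsto.enorm ?_
    have := ((hn.mul_const (‖w‖ ^ 2)).neg.rexp).const_mul (radialFourier ψ w)
    simpa using this
  have hfatou := lintegral_liminf_le' (u := atTop) (μ := (volume : Measure V)) (fun n : ℕ =>
    (hG (1 / ((n : ℝ) + 1)) (by positivity)).aestronglyMeasurable.enorm)
  simp only [fun w => (hlim w).liminf_eq] at hfatou
  refine (hfatou.trans (liminf_le_of_frequently_le' (Frequently.of_forall fun n => ?_))).trans_lt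
    (ENNReal.one_lt_top)
  have hpos : (0 : ℝ) < 1 / ((n : ℝ) + 1) := by positivity
  have h1 := integral_radialFourier_mul_gaussian_le hi hψ hpos
  rw [← ofReal_integral_norm_eq_lintegral_enorm (hG _ hpos), ← ENNReal.ofReal_one]
  refine ENNReal.ofReal_le_ofReal (le_trans (le_of_eq ?_) h1)
  refine integral_congr_ae (ae_of_all _ fun w => ?_)
  exact Real.norm_of_nonneg (mul_nonneg (h.radialFourier_nonneg hi w) (Real.exp_nonneg _))

end GaussPos

/-! ### The stable density and the Green function in `L¹` -/

theorem integrable_exp_neg_rpow_norm {V : Type*} [NormedAddCommGroup V] [InnerProductSpace ℝ V]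
    [FiniteDimensional ℝ V] [MeasurableSpace V] [BorelSpace V] [Nontrivial V] {β c : ℝ}
    (h0 : 0 < β) (hc : 0 < c) :
    Integrable fun v : V => Real.exp (-((c * ‖v‖) ^ (2 * β))) := by
  refine (integrable_fun_norm_addHaar (volume : Measure V)
    (f := fun r => Real.exp (-((c * r) ^ (2 * β))))).2 ?_
  refine (integrableOn_rpow_mul_exp_neg_mul_rpow (p := 2 * β) (b := c ^ (2 * β))
    (s := ((Module.finrank ℝ V - 1 : ℕ) : ℝ)) ?_ (by positivity) (by positivity)).congr_fun
    (fun r hr => ?_) measurableSet_Ioi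
  · have : (0 : ℝ) ≤ ((Module.finrank ℝ V - 1 : ℕ) : ℝ) := Nat.cast_nonneg _
    linarith
  · simp only [smul_eq_mul]
    rw [Real.rpow_natCast, Real.mul_rpow hc.le (le_of_lt hr), neg_mul]

theorem stableDensity_eq_radialFourier {d : ℕ} {β : ℝ} (h0 : 0 < β)
    [Nontrivial (EuclideanSpace ℝ (Fin d))] (x : EuclideanSpace ℝ (Fin d)) :
    stableDensity d β x =
      radialFourier (fun l => Real.exp (-((2 * Real.pi) ^ 2 * l) ^ β)) x := by
  have hi := integrable_exp_neg_rpow_norm (V := EuclideanSpace ℝ (Fin d)) h0 Real.two_pi_pos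
  rw [stableDensity, Real.fourierInv_eq', radialFourier, ← RCLike.re_eq_complex_re, ← integral_re]
  · refine integral_congr_ae (ae_of_all _ fun v => ?_)
    simp only [RCLike.re_eq_complex_re]
    rw [smul_eq_mul, Complex.re_mul_ofReal, Complex.exp_ofReal_mul_I_re, mul_comm]
    rw [← mul_pow, ← Real.rpow_natCast (_ * _), ← Real.rpow_mul (by positivity)]
    norm_num
  · refine (hi.ofReal (𝕜 := ℂ)).bdd_mul (c := 1)
      (Continuous.aestronglyMeasurable (by fun_prop)) (ae_of_all _ fun v => ?_)
    rw [Complex.norm_exp_ofReal_mul_I]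

/-- The stable density is integrable. -/
theorem integrable_stableDensity (d : ℕ) {β : ℝ} (h0 : 0 < β) (h1 : β ≤ 1) :
    Integrable (stableDensity d β) := by
  -- In dimension `0` the origin is not a null set, but the space is one point of finite measure.
  rcases subsingleton_or_nontrivial (EuclideanSpace ℝ (Fin d)) with hs | hs
  · have : IsFiniteMeasure (volume : Measure (EuclideanSpace ℝ (Fin d))) :=
      ⟨((Set.toFinite univ).isCompact).measure_lt_top⟩
    exact Integrable.of_finite
  · rw [funext (stableDensity_eq_radialFourier h0)]
    refine (GaussPos.exp_neg_rpow h0 h1 (by positivity)).integrable_radialFourier ?_ fun l hl =>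
      Real.exp_le_one_iff.2 (neg_nonpos.2 (by positivity))
    refine (integrable_exp_neg_rpow_norm (V := EuclideanSpace ℝ (Fin d)) h0
      Real.two_pi_pos).congr (ae_of_all _ fun v => ?_)
    simp only
    rw [← mul_pow, ← Real.rpow_natCast (_ * _), ← Real.rpow_mul (by positivity)]
    norm_num

theorem integrable_greenFunction (d : ℕ) {σ β t : ℝ} (h0 : 0 < β) (h1 : β ≤ 1) (ht : 0 < σ * t) :
    Integrable (greenFunction d σ β t) :=
  (((integrable_comp_smul_iff volume (stableDensity d β)
    (Real.rpow_pos_of_pos ht _).ne').2 (integrable_stableDensity d h0 h1))).const_mul _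

/-- The scaling of `G` preserves the `L¹` norm, so the bound on `S(t)` is independent of `t`. -/
theorem integral_norm_greenFunction (d : ℕ) {σ β t : ℝ} (ht : 0 < σ * t) :
    ∫ x, ‖greenFunction d σ β t x‖ = ∫ x, ‖stableDensity d β x‖ := by
  simp only [greenFunction, norm_mul]
  rw [integral_const_mul, Measure.integral_comp_smul volume (fun x => ‖stableDensity d β x‖),
    Real.norm_of_nonneg (Real.rpow_nonneg ht.le _), abs_of_nonneg (by positivity), smul_eq_mul,
    ← mul_assoc, finrank_euclideanSpace_fin, ← Real.rpow_natCast, ← Real.rpow_mul ht.le,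
    ← Real.rpow_neg ht.le, ← Real.rpow_add ht]
  rw [show -((d : ℝ) / (2 * β)) + -(-(1 / (2 * β)) * d) = 0 by ring, Real.rpow_zero, one_mul]

/-! ### Translations and sup-norm bounds for the semigroup -/

section Semigroup

variable {d : ℕ} {Z : Type*} [NormedAddCommGroup Z] [NormedSpace ℝ Z]

theorem fracSemigroup_translate (σ β t : ℝ) (f : EuclideanSpace ℝ (Fin d) → Z)
    (x v : EuclideanSpace ℝ (Fin d)) :
    fracSemigroup σ β t f (x + v) = fracSemigroup σ β t (fun y => f (y + v)) x := by
  simp only [fracSemigroup, add_sub_right_comm]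

/-- Young's inequality; the `1` in the maximum covers `S(t) = id`. The bound `B` serves only to make
both convolutions integrable and is absent from the estimate. -/
theorem norm_fracSemigroup_sub_le {σ β t : ℝ} (h0 : 0 < β) (h1 : β ≤ 1) (ht : 0 ≤ σ * t)
    {f f' : EuclideanSpace ℝ (Fin d) → Z} (hf : Continuous f) (hf' : Continuous f') {B D : ℝ}
    (hB : ∀ y, ‖f y‖ ≤ B) (hB' : ∀ y, ‖f' y‖ ≤ B) (hD : ∀ y, ‖f y - f' y‖ ≤ D)
    (x : EuclideanSpace ℝ (Fin d)) :
    ‖fracSemigroup σ β t f x - fracSemigroup σ β t f' x‖ ≤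
      max 1 (∫ y, ‖stableDensity d β y‖) * D := by
  have hD0 : 0 ≤ D := (norm_nonneg _).trans (hD x)
  rcases ht.eq_or_lt with h | h
  · simp only [fracSemigroup, ← h, if_true]
    exact (hD x).trans (le_mul_of_one_le_left hD0 (le_max_left _ _))
  · simp only [fracSemigroup, h.ne', if_false]
    have hG := integrable_greenFunction d h0 h1 h
    have hi : ∀ {k : EuclideanSpace ℝ (Fin d) → Z}, Continuous k → (∀ y, ‖k y‖ ≤ B) →
        Integrable fun y => greenFunction d σ β t y • k (x - y) := fun hk hkB =>
      hG.smul_bdd B (Continuous.aestronglyMeasurable (by fun_prop))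
        (ae_of_all _ fun y => hkB (x - y))
    rw [← integral_sub (hi hf hB) (hi hf' hB')]
    refine (norm_integral_le_of_norm_le (hG.norm.mul_const D)
      (ae_of_all _ fun y => ?_)).trans ?_
    · rw [← smul_sub, norm_smul]
      exact mul_le_mul_of_nonneg_left (hD _) (norm_nonneg _)
    · rw [integral_mul_const, integral_norm_greenFunction d h]
      exact mul_le_mul_of_nonneg_right (le_max_right _ _) hD0

end Semigroup

/-! ### Grönwall's inequality and invariance of mild solutions -/

/-- Grönwall's inequality in integral form, with zero initial value. -/
theorem eq_zero_of_le_mul_integral {m : ℝ → ℝ} {K T : ℝ} (hm : ContinuousOn m (Icc 0 T))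
    (hm0 : ∀ t ∈ Icc 0 T, 0 ≤ m t) (h : ∀ t ∈ Icc 0 T, m t ≤ K * ∫ s in (0 : ℝ)..t, m s) :
    ∀ t ∈ Icc 0 T, m t = 0 := by
  intro t ht
  have hT : 0 ≤ T := ht.1.trans ht.2
  -- Extending `m` by constants makes its primitive differentiable everywhere, endpoints included.
  set n : ℝ → ℝ := IccExtend hT ((Icc 0 T).domRestrict m) with hn
  have hnc : Continuous n := (continuousOn_iff_continuous_domRestrict.1 hm).Icc_extend'
  have hnm : ∀ s ∈ Icc 0 T, n s = m s := fun s hs => IccExtend_of_mem hT _ hs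
  have hint : ∀ s ∈ Icc 0 T, ∫ r in (0 : ℝ)..s, m r = ∫ r in (0 : ℝ)..s, n r := fun s hs =>
    intervalIntegral.integral_congr fun r hr => by
      rw [uIcc_of_le hs.1] at hr
      exact (hnm r ⟨hr.1, hr.2.trans hs.2⟩).symm
  have hder : ∀ s, HasDerivAt (fun s => ∫ r in (0 : ℝ)..s, n r) (n s) s := fun s =>
    intervalIntegral.integral_hasDerivAt_right (hnc.intervalIntegrable _ _)
      (hnc.stronglyMeasurableAtFilter _ _) hnc.continuousAt
  have hzero := eq_zero_of_abs_deriv_le_mul_abs_self_of_eq_zero_right (K := |K|) (a := 0) (b := T)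
    (f := fun s => ∫ r in (0 : ℝ)..s, n r) (f' := n)
    (fun s _ => (hder s).continuousAt.continuousWithinAt)
    (fun s _ => (hder s).hasDerivWithinAt) intervalIntegral.integral_same (fun s hs => by
      have hs' : s ∈ Icc 0 T := ⟨hs.1, hs.2.le⟩
      rw [hnm s hs', Real.norm_of_nonneg (hm0 s hs'), ← hint s hs', Real.norm_eq_abs, ← abs_mul]
      exact (h s hs').trans (le_abs_self _))
  refine le_antisymm ?_ (hm0 t ht)
  have := h t ht
  rwa [hint t ht, hzero t ht, mul_zero] at this

/-- Mild solutions inherit translation invariance from the initial datum. -/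
theorem IsMildSolutionOn.translation_invariant {d : ℕ} {Z : Type*} [NormedAddCommGroup Z]
    [NormedSpace ℝ Z] {σ β : ℝ} (hσ : 0 ≤ σ) (hβ₀ : 0 < β) (hβ₁ : β ≤ 1) {F : ℝ → Z → Z}
    (hFcont : ContinuousOn (fun p : ℝ × Z => F p.1 p.2) (Set.Ici 0 ×ˢ Set.univ))
    (hFlip : LocallyLipschitzInSnd F) {u₀ : Cu d Z} {v : EuclideanSpace ℝ (Fin d)}
    (hu₀ : ∀ x, u₀.1 (x + v) = u₀.1 x) {u : ℝ → Cu d Z} {T : ℝ}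
    (hu : IsMildSolutionOn σ β F u₀ (Icc 0 T) u) :
    ∀ t ∈ Icc 0 T, ∀ x, (u t).1 (x + v) = (u t).1 x := by
  intro t₀ ht₀
  have hT : 0 ≤ T := ht₀.1.trans ht₀.2
  have huc : ContinuousOn (fun s => (u s).1) (Icc 0 T) :=
    continuous_subtype_val.comp_continuousOn hu.continuousOn
  obtain ⟨R₀, hR₀⟩ := isCompact_Icc.exists_bound_of_continuousOn huc
  obtain ⟨R, hRpos, hR⟩ : ∃ R > 0, ∀ s ∈ Icc 0 T, ∀ y, ‖(u s).1 y‖ ≤ R :=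
    ⟨max R₀ 1, lt_max_of_lt_right one_pos, fun s hs y =>
      (((u s).1.norm_coe_le_norm y).trans (hR₀ s hs)).trans (le_max_left _ _)⟩
  -- `T + 1` because the Lipschitz condition needs a positive time and `T` may be `0`.
  obtain ⟨L, hLpos, hL⟩ := hFlip R hRpos (T + 1) (by linarith)
  have hL' : ∀ s ∈ Icc 0 T, ∀ z z' : Z, ‖z‖ ≤ R → ‖z'‖ ≤ R → ‖F s z - F s z'‖ ≤ L * ‖z - z'‖ :=
    fun s hs => hL s ⟨hs.1, by linarith [hs.2]⟩
  set τ : C(EuclideanSpace ℝ (Fin d), EuclideanSpace ℝ (Fin d)) := ⟨fun x => x + v, by fun_prop⟩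
  set m : ℝ → ℝ := fun s => ‖(u s).1.compContinuous τ - (u s).1‖ with hm
  have hmc : ContinuousOn m (Icc 0 T) :=
    ((((BoundedContinuousFunction.continuous_compContinuous τ).comp_continuousOn huc)).sub
      huc).norm
  have hmle : ∀ s y, ‖(u s).1 (y + v) - (u s).1 y‖ ≤ m s := fun s y =>
    ((u s).1.compContinuous τ - (u s).1).norm_coe_le_norm y
  set C : ℝ := max 1 (∫ y, ‖stableDensity d β y‖)
  have hC : 0 ≤ C := zero_le_one.trans (le_max_left _ _)
  have key : ∀ t ∈ Icc 0 T, m t ≤ (C * L) * ∫ s in (0 : ℝ)..t, m s := by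
    intro t ht
    have hm_int : IntervalIntegrable m volume 0 t :=
      (hmc.mono (by rw [uIcc_of_le ht.1]; exact Icc_subset_Icc_right ht.2)).intervalIntegrable
    have hint_nonneg : 0 ≤ ∫ s in (0 : ℝ)..t, m s :=
      intervalIntegral.integral_nonneg ht.1 fun s _ => norm_nonneg _
    refine (BoundedContinuousFunction.norm_le (by positivity)).2 fun x => ?_
    change ‖(u t).1 (x + v) - (u t).1 x‖ ≤ _
    rw [hu.equation t ht (x + v), hu.equation t ht x, fracSemigroup_translate]
    -- The terms `S(t) u₀` now agree by invariance of the datum and cancel.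
    simp only [hu₀]
    rw [add_sub_add_left_eq_sub, ← intervalIntegral.integral_sub (hu.integrable t ht (x + v))
      (hu.integrable t ht x), ← intervalIntegral.integral_const_mul]
    refine intervalIntegral.norm_integral_le_of_norm_le ht.1 (ae_of_all _ fun s hs => ?_)
      (hm_int.const_mul _)
    have hs' : s ∈ Icc 0 T := ⟨hs.1.le, hs.2.trans ht.2⟩
    have hfc : Continuous fun y => F s ((u s).1 y) :=
      hFcont.comp_continuous (f := fun y => (s, (u s).1 y)) (by fun_prop) fun y =>
        ⟨hs'.1, mem_univ _⟩
    have hfB : ∀ y, ‖F s ((u s).1 y)‖ ≤ ‖F s 0‖ + L * R := fun y => by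
      have h1 := hL' s hs' ((u s).1 y) 0 (hR s hs' y) (by simpa using hRpos.le)
      rw [sub_zero] at h1
      have h2 := mul_le_mul_of_nonneg_left (hR s hs' y) hLpos.le
      have h3 := norm_le_norm_add_norm_sub' (F s ((u s).1 y)) (F s 0)
      linarith
    rw [fracSemigroup_translate, mul_assoc]
    refine norm_fracSemigroup_sub_le hβ₀ hβ₁ (mul_nonneg hσ (sub_nonneg.2 hs.2))
      (hfc.comp (continuous_add_const v)) hfc (fun y => hfB (y + v)) hfB (fun y => ?_) x
    exact (hL' s hs' _ _ (hR s hs' _) (hR s hs' _)).trans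
      (mul_le_mul_of_nonneg_left (hmle s y) hLpos.le)
  intro x
  have hz := eq_zero_of_le_mul_integral hmc (fun s _ => norm_nonneg _) key t₀ ht₀
  have := hmle t₀ x
  rw [hz] at this
  exact sub_eq_zero.1 (norm_le_zero_iff.1 this)

theorem IsMildSolutionOn.mono {d : ℕ} {Z : Type*} [NormedAddCommGroup Z]
    [NormedSpace ℝ Z] {σ β : ℝ} {F : ℝ → Z → Z} {u₀ : Cu d Z} {u : ℝ → Cu d Z} {I J : Set ℝ}
    (hu : IsMildSolutionOn σ β F u₀ I u) (h : J ⊆ I) : IsMildSolutionOn σ β F u₀ J u :=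
  ⟨hu.continuousOn.mono h, fun t ht => hu.integrable t (h ht), fun t ht => hu.equation t (h ht)⟩

theorem mainTheorem3 {d q : ℕ} {Z : Type*} [NormedAddCommGroup Z] [NormedSpace ℝ Z]
    [CompleteSpace Z] (σ β : ℝ) (hσ : 0 ≤ σ) (hβ₀ : 0 < β) (hβ₁ : β ≤ 1)
    (F : ℝ → Z → Z)
    (hFcont : ContinuousOn (fun p : ℝ × Z => F p.1 p.2) (Set.Ici 0 ×ˢ Set.univ))
    (hFlip : LocallyLipschitzInSnd F)
    (γ : Fin q → EuclideanSpace ℝ (Fin d)) (hγ : LinearIndependent ℝ γ)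
    (u₀ : Cu d Z) (hu₀ : u₀ ∈ CuPeriodic Z (latticeOf γ))
    (u : ℝ → Cu d Z)
    (hu : IsMildSolutionOn σ β F u₀ {t : ℝ | 0 ≤ t ∧ (t : EReal) < maximalTime σ β F u₀} u) :
    ∀ t : ℝ, 0 ≤ t → (t : EReal) < maximalTime σ β F u₀ →
      u t ∈ CuPeriodic Z (latticeOf γ) := by
  intro t ht htT v hv x
  -- Restriction to `[0, t]` gives the compactness that bounds `u`, hence a single Lipschitz
  -- constant.
  have hsub : Icc 0 t ⊆ {t : ℝ | 0 ≤ t ∧ (t : EReal) < maximalTime σ β F u₀} := fun s hs =>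
    ⟨hs.1, (EReal.coe_le_coe_iff.2 hs.2).trans_lt htT⟩
  exact (hu.mono hsub).translation_invariant hσ hβ₀ hβ₁ hFcont hFlip (hu₀ v hv) t
    (right_mem_Icc.2 ht) x
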